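/- Let $N$ be a free abelian group of rank $r$, $M=\mathrm{Hom}(N,\mathbf Z)$, and let $K\subset N\otimes\mathbf R$ be a full-dimensional rational polyhedral cone with $K\cap(-K)=\{0\}$. Assume that $K$ is graded: there is $\deg\in M$ that takes the value $1$ on the primitive integer generators of all one-dimensional faces of $K$. Let $K^{open}$ be the interior of $K$, and let $e_1,\dots,e_d$ be distinct points of $K\cap N$ of degree $1$ with $\sum_{i}\mathbf R_{\ge 0}e_i=K$. Let $T$ be a maximum regular triangulation of $K$ based on the $e_i$; that is, $K$ is subdivided into simplicial cones $\sum_{i\in I}\mathbf R_{\ge0}e_i$, $I\in T$, every $e_i$ is a vertex of $T$, and there is a strictly convex function on $K$ that is linear on the cones of $T$. (Strictly convex means: convex, and additive on a pair of points only if both lie in a common cone of $T$.) Fix $\xi\in K^{open}$ that is generic in the sense that for every simplex $I\in T$ of maximum dimension (i.e. $|I|=r$) all coefficients in $\xi=\sum_{i\in I}\beta_{I,i}e_i$ are non-zero. For such $I$ let $B_{I,\xi}$ be the set of all $b=\sum_{i\in I}\gamma_ie_i\in N$ with $0<\gamma_i\le 1$ if $\beta_{I,i}<0$ and $0\le\gamma_i<1$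 if $\beta_{I,i}>0$, and let $B_{I,-\xi}$ be the set of all $b=\sum_{i\in I}\gamma_ie_i\in N$ with $0<\gamma_i\le 1$ if $\beta_{I,i}>0$ and $0\le\gamma_i<1$ if $\beta_{I,i}<0$. Let $R=\mathbf C[K]$ be the semigroup ring of $K\cap N$, with elements $x^n$ for $n\in K\cap N$, put $x_i=x^{e_i}$, and let $R^{open}=\mathbf C[K^{open}]$ be the ideal of $R$ spanned by the $x^n$ with $n\in K^{open}\cap N$. Fix a basis $m_1,\dots,m_r$ of $M\otimes\mathbf C$. For $a=(a_1,\dots,a_d)\in\mathbf C^d$ put $$Z_j=\sum_{i=1}^d\langle m_j,e_i\rangle\,e^{2\pi\mathrm i a_i}x_i\in R\qquad(j=1,\dots,r),$$ and let $Z$ be the ideal of $R$ generated by $Z_1,\dots,Z_r$. Then for generic $a$ both of the following hold; precisely, there is a non-zero polynomial $P\in\mathbf C[y_1,\dots,y_d]$ such that they hold for every $a\in\mathbf C^d$ with $P(e^{2\pi\mathrm i a_1},\dots,e^{2\pi\mathrm i a_d})\ne0$: (a) the images of $x^b$, for $b\in\bigcup_I B_{I,\xi}$, span $R/ZR$ as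 a $\mathbf C$-vector space; (b) the images of $x^b$, for $b\in\bigcup_I B_{I,-\xi}$, span $R^{open}/ZR^{open}$ as a $\mathbf C$-vector space. Here $I$ runs over the simplices of $T$ of maximum dimension. -/

import Mathlib

open scoped TensorProduct

noncomputable section

namespace ToricCone

variable {V : Type*} [NormedAddCommGroup V] [NormedSpace ℝ V]

/-- The monoid `K ∩ N` of lattice points of a cone `K` in `V = N ⊗ ℝ`, where the lattice `N`
is given as a `ℤ`-submodule `L` of `V`. -/
def latticePoints (L : Submodule ℤ V) (K : PointedCone ℝ V) : AddSubmonoid V :=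
  L.toAddSubmonoid ⊓ K.toAddSubmonoid

/-- The inclusion of `K ∩ N` in `N`. -/
def toLattice {L : Submodule ℤ V} {K : PointedCone ℝ V} (n : latticePoints L K) : L :=
  ⟨(n : V), n.2.1⟩

/-- The semigroup ring `R = ℂ[K]` of the monoid `K ∩ N`. -/
abbrev coneRing (L : Submodule ℤ V) (K : PointedCone ℝ V) : Type _ :=
  AddMonoidAlgebra ℂ (latticePoints L K)

/-- The element `x ^ n` of `ℂ[K]`, for `n ∈ K ∩ N`. -/
def monom {L : Submodule ℤ V} {K : PointedCone ℝ V} (n : latticePoints L K) : coneRing L K :=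
  AddMonoidAlgebra.single n 1

theorem add_mem_interior {K : PointedCone ℝ V} {x y : V} (hx : x ∈ K)
    (hy : y ∈ interior (K : Set V)) : x + y ∈ interior (K : Set V) := by
  have h : (fun z => x + z) '' interior (K : Set V) ⊆ (K : Set V) := by
    rintro _ ⟨z, hz, rfl⟩
    exact K.add_mem hx (interior_subset hz)
  exact interior_maximal h (isOpenMap_add_left x _ isOpen_interior) ⟨y, hy, rfl⟩

/-- The ideal `ℂ[K^open]` of `ℂ[K]`: the elements all of whose monomials `x ^ n` have `n` in the
interior of `K`. -/
def openIdeal (L : Submodule ℤ V) (K : PointedCone ℝ V) : Ideal (coneRing L K) where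
  carrier := {f | ∀ n ∈ f.coeff.support, (n : V) ∈ interior (K : Set V)}
  zero_mem' := by
    intro n hn
    simp at hn
  add_mem' := by
    classical
    intro f g hf hg n hn
    rcases Finset.mem_union.1 (Finsupp.support_add hn) with h | h
    · exact hf n h
    · exact hg n h
  smul_mem' := by
    classical
    intro f g hg n hn
    obtain ⟨a, _, b, hb, rfl⟩ := Finset.mem_add.1 (AddMonoidAlgebra.support_coeff_mul_subset f g hn)
    exact add_mem_interior a.2.2 (hg b hb)

/-- The pairing `⟨m, n⟩` of `m ∈ M ⊗ ℂ` with `n ∈ N`, where `M = Hom(N, ℤ)`. -/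
def pairing (L : Submodule ℤ V) (m : ℂ ⊗[ℤ] Module.Dual ℤ L) (n : L) : ℂ :=
  (Module.Dual.eval ℤ L n).baseChange ℂ m

variable {L : Submodule ℤ V} {K : PointedCone ℝ V} {d : ℕ}

/-- `K` is a full-dimensional strictly convex cone, `deg` is an integral linear form, and
`e_1, …, e_d` are distinct lattice points of `K` of degree one that generate `K` as a cone.
(Then the primitive generator of each one-dimensional face of `K` is one of the `e_i`, so that
`K` is a rational polyhedral cone graded by `deg`.) -/
structure IsGradedCone (deg : Module.Dual ℤ L) (e : Fin d → latticePoints L K) : Prop where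
  sub_eq : ∀ v : V, ∃ x ∈ K, ∃ y ∈ K, v = x - y
  salient : ∀ x ∈ K, -x ∈ K → x = 0
  injective : Function.Injective e
  deg_eq_one : ∀ i, deg (toLattice (e i)) = 1
  hull_eq : PointedCone.hull ℝ (Set.range fun i => (e i : V)) = K

/-- The cone `∑_{i ∈ I} ℝ_{≥ 0} e_i`. -/
def simplexCone (e : Fin d → latticePoints L K) (I : Finset (Fin d)) : PointedCone ℝ V :=
  PointedCone.hull ℝ ((fun i => (e i : V)) '' (I : Set (Fin d)))

/-- The simplices of maximum dimension of `T`: those with `r = dim V` vertices. -/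
def maxSimplices (V : Type*) [NormedAddCommGroup V] [NormedSpace ℝ V]
    (T : Finset (Finset (Fin d))) : Set (Finset (Fin d)) :=
  {I | I ∈ T ∧ I.card = Module.finrank ℝ V}

/-- `T` is a triangulation of `K` with vertices among the `e_i`, each simplex being given by the
set of indices of its vertices. As `K` is full-dimensional, it is the union of the cones over the
simplices of maximum dimension. -/
structure IsTriangulation (e : Fin d → latticePoints L K) (T : Finset (Finset (Fin d))) :
    Prop where
  linearIndependent : ∀ I ∈ T, LinearIndependent ℝ fun i : I => (e i : V)
  down_closed : ∀ I ∈ T, ∀ J ⊆ I, J ∈ T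
  inter_eq : ∀ I ∈ T, ∀ J ∈ T, simplexCone e I ⊓ simplexCone e J = simplexCone e (I ∩ J)
  cover : ∀ x ∈ K, ∃ I ∈ maxSimplices V T, x ∈ simplexCone e I

/-- `ψ` is a strictly convex function on `K` that is linear on the simplices of `T`: it is convex
and additive only on pairs of points that lie in the cone over a common simplex. -/
structure IsStrictlyConvexSupport (e : Fin d → latticePoints L K) (T : Finset (Finset (Fin d)))
    (ψ : V → ℝ) : Prop where
  convexOn : ConvexOn ℝ (K : Set V) ψ
  linear : ∀ I ∈ T, ∃ l : V →ₗ[ℝ] ℝ, ∀ x ∈ simplexCone e I, ψ x = l x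
  strict : ∀ x ∈ K, ∀ y ∈ K, ψ (x + y) = ψ x + ψ y →
    ∃ I ∈ T, x ∈ simplexCone e I ∧ y ∈ simplexCone e I

/-- `T` is a maximum regular triangulation of `K` based on the points `e_i`: a regular
triangulation that cannot be refined, that is, one in which each `e_i` is a vertex. -/
structure IsMaximumRegularTriangulation (e : Fin d → latticePoints L K)
    (T : Finset (Finset (Fin d))) : Prop extends IsTriangulation e T where
  regular : ∃ ψ : V → ℝ, IsStrictlyConvexSupport e T ψ
  vertex : ∀ i, {i} ∈ T

/-- `ξ` lies in the interior of `K` and all its coordinates `β_{I,i}` with respect to the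
simplices `I` of maximum dimension are non-zero. -/
structure IsGenericInterior (e : Fin d → latticePoints L K) (T : Finset (Finset (Fin d)))
    (ξ : V) : Prop where
  mem_interior : ξ ∈ interior (K : Set V)
  coord_ne_zero : ∀ I ∈ maxSimplices V T, ∀ β : Fin d → ℝ,
    ξ = ∑ i ∈ I, β i • (e i : V) → ∀ i ∈ I, β i ≠ 0

/-- The set `B_{I,ξ}`, for a simplex `I` of maximum dimension. As the coordinates of `-ξ` are the
negatives of those of `ξ`, the set `B_{I,-ξ}` is this set for the vector `-ξ`. -/
def boxSet (e : Fin d → latticePoints L K) (I : Finset (Fin d)) (ξ : V) :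
    Set (latticePoints L K) :=
  {b | ∃ β γ : Fin d → ℝ, ξ = ∑ i ∈ I, β i • (e i : V) ∧ (b : V) = ∑ i ∈ I, γ i • (e i : V) ∧
    ∀ i ∈ I, (β i < 0 → 0 < γ i ∧ γ i ≤ 1) ∧ (0 < β i → 0 ≤ γ i ∧ γ i < 1)}

/-- The union of the sets `B_{I,ξ}` over the simplices `I` of maximum dimension. -/
def boxUnion (e : Fin d → latticePoints L K) (T : Finset (Finset (Fin d))) (ξ : V) :
    Set (latticePoints L K) :=
  {b | ∃ I ∈ maxSimplices V T, b ∈ boxSet e I ξ}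

/-- The element `∑ i, ⟨m, e_i⟩ exp(2 π i a_i) x_i` of `ℂ[K]`, where `x_i = x ^ {e_i}`. -/
def linearElement (e : Fin d → latticePoints L K) (a : Fin d → ℂ)
    (m : ℂ ⊗[ℤ] Module.Dual ℤ L) : coneRing L K :=
  ∑ i, (pairing L m (toLattice (e i)) * Complex.exp (2 * Real.pi * Complex.I * a i)) •
    monom (e i)

/-- The ideal `Z` generated by `Z_1, …, Z_r`, for `m_1, …, m_r` in `M ⊗ ℂ`. -/
def idealZ {r : ℕ} (e : Fin d → latticePoints L K) (a : Fin d → ℂ)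
    (m : Fin r → ℂ ⊗[ℤ] Module.Dual ℤ L) : Ideal (coneRing L K) :=
  Ideal.span (Set.range fun j => linearElement e a (m j))

end ToricCone

end

open Filter Topology

/-! Both parts are one statement for a direction `η = ±ξ`. The points `n` of `K ∩ N` with `n + ε η ∈
K` for small `ε > 0` are all of `K ∩ N` when `η = ξ`, and the interior points when `η = -ξ`. Each
such `n` has a maximal simplex `I` whose open cone contains `n + ε η`; the box points of `I` are
those from which no `e_i`, `i ∈ I`, can be subtracted while keeping this property.

In one degree, spanning means that some maximal minor, polynomial in the coefficients `z_i`, is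
non-zero; one good `z` therefore suffices. Put `z_i = exp(-τ ψ(e_i))` and rescale `x^n` by `exp(-τ
ψ(n))`. As `τ → ∞`, the multiplication degenerates: `x^n x_i` survives only if `ψ` is additive on
`n, e_i` (`exists_shiftFamily_span_eq_top`).

In the degenerate ring (`span_shiftFamily_eq_top_of_support`), let `n = n' + e_i` with `i ∈ I` and
`n'` still adapted to `I`. The linear relation given by the `i`-th coordinate of `I`, multiplied by
`x^{n'}`, expresses `x^n` through surviving `x^{n' + e_{i'}}` with `i' ∉ I`. These are adapted to
simplices on which the linear piece of `ψ` takes a smaller value at `η` (`apply_lt_of_isAdapted`),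
so an induction over the simplices ends in box points. Finitely many degrees control all others,
since box points have degree at most `r`. -/

/-! ### Spanning as an open and polynomial condition; degeneration by weights. -/

theorem span_range_eq_top_of_det_ne_zero {ι ν : Type*} [Fintype ν] [DecidableEq ν]
    (w : ι → ν → ℂ) (s : ν → ι) (h : (Matrix.of fun x => w (s x)).det ≠ 0) :
    Submodule.span ℂ (Set.range w) = ⊤ := by
  have hli : LinearIndependent ℂ (fun x => w (s x)) :=
    Matrix.linearIndependent_rows_of_det_ne_zero h
  have htop := hli.span_eq_top_of_card_eq_finrank' (by simp)
  rw [eq_top_iff, ← htop]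
  refine Submodule.span_mono ?_
  rintro _ ⟨x, rfl⟩
  exact ⟨s x, rfl⟩

theorem exists_det_ne_zero_of_span_range_eq_top {ι ν : Type*} [Fintype ν] [DecidableEq ν]
    (w : ι → ν → ℂ) (h : Submodule.span ℂ (Set.range w) = ⊤) :
    ∃ s : ν → ι, (Matrix.of fun x => w (s x)).det ≠ 0 := by
  obtain ⟨κ, a, -, hspan, hli⟩ := exists_linearIndependent' ℂ w
  let b : Module.Basis κ ℂ (ν → ℂ) := Module.Basis.mk hli (by rw [hspan, h])
  let f : ν ≃ κ := (Pi.basisFun ℂ ν).indexEquiv b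
  refine ⟨a ∘ f, ?_⟩
  have h2 : LinearIndependent ℂ (Matrix.of fun x => w ((a ∘ f) x)).row :=
    hli.comp f f.injective
  rw [Matrix.linearIndependent_rows_iff_isUnit, Matrix.isUnit_iff_isUnit_det] at h2
  exact h2.ne_zero

/-- A maximal minor that is non-zero in the limit is non-zero nearby; only finitely many of the
vectors enter it. -/
theorem eventually_span_range_eq_top {ι ν α : Type*} [Finite ν] {l : Filter α}
    {w : α → ι → ν → ℂ} {w₀ : ι → ν → ℂ}
    (hw : ∀ i x, Tendsto (fun t => w t i x) l (𝓝 (w₀ i x)))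
    (h : Submodule.span ℂ (Set.range w₀) = ⊤) :
    ∀ᶠ t in l, Submodule.span ℂ (Set.range (w t)) = ⊤ := by
  classical
  have := Fintype.ofFinite ν
  obtain ⟨s, hs⟩ := exists_det_ne_zero_of_span_range_eq_top w₀ h
  have hM : Tendsto (fun t => (Matrix.of fun x => w t (s x))) l
      (𝓝 (Matrix.of fun x => w₀ (s x))) :=
    tendsto_pi_nhds.2 fun x => tendsto_pi_nhds.2 fun y => hw (s x) y
  have hdet := ((continuous_id.matrix_det (R := ℂ) (n := ν)).tendsto _).comp hM
  filter_upwards [hdet.eventually_ne hs] with t ht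
  exact span_range_eq_top_of_det_ne_zero _ s ht

theorem exists_mvPolynomial_span_range_eq_top {ι ν σ : Type*} [Finite ν]
    (p : ι → ν → MvPolynomial σ ℂ) (z₀ : σ → ℂ)
    (h : Submodule.span ℂ (Set.range fun i x => MvPolynomial.eval z₀ (p i x)) = ⊤) :
    ∃ P : MvPolynomial σ ℂ, P ≠ 0 ∧ ∀ z, MvPolynomial.eval z P ≠ 0 →
      Submodule.span ℂ (Set.range fun i x => MvPolynomial.eval z (p i x)) = ⊤ := by
  classical
  have := Fintype.ofFinite ν
  obtain ⟨s, hs⟩ := exists_det_ne_zero_of_span_range_eq_top _ h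
  have key : ∀ z : σ → ℂ, MvPolynomial.eval z (Matrix.of fun x => p (s x)).det =
      (Matrix.of fun x y => MvPolynomial.eval z (p (s x) y)).det := by
    intro z
    rw [RingHom.map_det]
    rfl
  refine ⟨(Matrix.of fun x => p (s x)).det, ?_, fun z hz => ?_⟩
  · intro h0
    apply hs
    rw [← key z₀, h0, map_zero]
  · rw [key] at hz
    exact span_range_eq_top_of_det_ne_zero _ s hz

/-- The vectors `δ_b`, for `b ∈ B`, and `∑ i, q j i y • δ_{s i y}`. -/
noncomputable def shiftFamily {X Y J σ : Type*} [Fintype σ] (s : σ → Y → X) (B : Set X)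
    {A : Type*} [Semiring A] (q : J → σ → Y → A) : B ⊕ J × Y → X → A :=
  open Classical in
  Sum.elim (fun b => Pi.single b.1 1) fun jy => ∑ i, Pi.single (s i jy.2) (q jy.1 i jy.2)

/-- With `z_i = exp(-τ ψσ i)`, rescaling the coordinates by `exp(τ ψX)` and the relations by `exp(τ
ψY)` turns the coefficients into `c j i * exp(-τ (ψY y + ψσ i - ψX (s i y)))`. They tend to the
truncated ones as `τ → ∞`, and spanning is open. -/
theorem exists_shiftFamily_span_eq_top {X Y J σ : Type*} [Finite X] [Fintype σ]
    (s : σ → Y → X) (B : Set X) (c : J → σ → ℂ) (ψX : X → ℝ) (ψY : Y → ℝ) (ψσ : σ → ℝ)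
    (hψ : ∀ i y, ψX (s i y) ≤ ψY y + ψσ i)
    (h : open Classical in Submodule.span ℂ (Set.range (shiftFamily s B fun j i y =>
      if ψX (s i y) = ψY y + ψσ i then c j i else 0)) = ⊤) :
    ∃ z : σ → ℂ,
      Submodule.span ℂ (Set.range (shiftFamily s B fun j i (_ : Y) => c j i * z i)) = ⊤ := by
  classical
  have hlim : ∀ᶠ τ : ℝ in atTop, Submodule.span ℂ (Set.range (shiftFamily s B fun j i y =>
      c j i * (Real.exp (-(τ * (ψY y + ψσ i - ψX (s i y)))) : ℂ))) = ⊤ := by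
    refine eventually_span_range_eq_top (fun i x => ?_) h
    rcases i with b | ⟨j, y⟩
    · exact tendsto_const_nhds
    · simp only [shiftFamily, Sum.elim_inr, Finset.sum_apply]
      refine tendsto_finsetSum _ fun i _ => ?_
      by_cases hx : x = s i y
      · subst hx
        simp only [Pi.single_eq_same]
        split_ifs with he
        · simp [he]
        · have hpos : 0 < ψY y + ψσ i - ψX (s i y) := by
            have := lt_of_le_of_ne (hψ i y) he
            linarith
          have h1 : Tendsto (fun τ : ℝ => Real.exp (-(τ * (ψY y + ψσ i - ψX (s i y)))))
              atTop (𝓝 0) :=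
            Real.tendsto_exp_neg_atTop_nhds_zero.comp (tendsto_id.atTop_mul_const hpos)
          have h2 := ((Complex.continuous_ofReal.tendsto _).comp h1).const_mul (c j i)
          simpa using h2
      · simp only [Pi.single_eq_of_ne hx]
        exact tendsto_const_nhds
  obtain ⟨τ, hτ⟩ := hlim.exists
  refine ⟨fun i => (Real.exp (-(τ * ψσ i)) : ℂ), ?_⟩
  -- The invertible diagonal rescaling; it sends each vector of the `τ`-family to a multiple of a
  -- vector of the family for `z`.
  let D : (X → ℂ) →ₗ[ℂ] (X → ℂ) :=
    LinearMap.pi fun x => (Real.exp (-(τ * ψX x)) : ℂ) • LinearMap.proj x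
  have hDs : ∀ (x : X) (u : ℂ), D (Pi.single x u) =
      Pi.single x ((Real.exp (-(τ * ψX x)) : ℂ) * u) := by
    intro x u
    ext x'
    by_cases hx : x' = x
    · subst hx; simp [D]
    · simp [D, Pi.single_eq_of_ne hx]
  have hD : Function.Surjective D := by
    intro f
    refine ⟨fun x => (Real.exp (-(τ * ψX x)) : ℂ)⁻¹ * f x, ?_⟩
    ext x
    have : (Real.exp (-(τ * ψX x)) : ℂ) ≠ 0 := by exact_mod_cast (Real.exp_pos _).ne'
    simp only [D, LinearMap.pi_apply, LinearMap.smul_apply, LinearMap.proj_apply, smul_eq_mul]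
    rw [mul_inv_cancel_left₀ this]
  rw [eq_top_iff, ← LinearMap.range_eq_top.2 hD, LinearMap.range_eq_map, ← hτ,
    Submodule.map_span, Submodule.span_le]
  rintro _ ⟨_, ⟨b | ⟨j, y⟩, rfl⟩, rfl⟩
  · simp only [shiftFamily, Sum.elim_inl]
    rw [hDs, ← smul_eq_mul, Pi.single_smul]
    exact Submodule.smul_mem _ _ (Submodule.subset_span ⟨Sum.inl b, rfl⟩)
  · have hmem : shiftFamily s B (fun j i (_ : Y) => c j i * (Real.exp (-(τ * ψσ i)) : ℂ))
        (Sum.inr (j, y)) ∈ Submodule.span ℂ (Set.range (shiftFamily s B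
          fun j i (_ : Y) => c j i * (Real.exp (-(τ * ψσ i)) : ℂ))) :=
      Submodule.subset_span ⟨_, rfl⟩
    refine Set.mem_of_eq_of_mem ?_ (Submodule.smul_mem _ (Real.exp (-(τ * ψY y)) : ℂ) hmem)
    simp only [shiftFamily, Sum.elim_inr, map_sum, Finset.smul_sum]
    refine Finset.sum_congr rfl fun i _ => ?_
    rw [hDs]
    rw [← Pi.single_smul (s i y) (Real.exp (-(τ * ψY y)) : ℂ), smul_eq_mul]
    congr 1
    have : (Real.exp (-(τ * ψX (s i y))) : ℂ) *
        (Real.exp (-(τ * (ψY y + ψσ i - ψX (s i y)))) : ℂ) =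
        (Real.exp (-(τ * ψY y)) : ℂ) * (Real.exp (-(τ * ψσ i)) : ℂ) := by
      rw [← Complex.ofReal_mul, ← Complex.ofReal_mul, ← Real.exp_add, ← Real.exp_add]
      congr 2
      ring
    linear_combination (c j i) * this

theorem exists_mvPolynomial_shiftFamily_span_eq_top {X Y J σ : Type*} [Finite X] [Fintype σ]
    (s : σ → Y → X) (B : Set X) (c : J → σ → ℂ) (z₀ : σ → ℂ)
    (h : Submodule.span ℂ (Set.range (shiftFamily s B fun j i (_ : Y) => c j i * z₀ i)) = ⊤) :
    ∃ P : MvPolynomial σ ℂ, P ≠ 0 ∧ ∀ z, MvPolynomial.eval z P ≠ 0 →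
      Submodule.span ℂ (Set.range (shiftFamily s B fun j i (_ : Y) => c j i * z i)) = ⊤ := by
  classical
  have key : ∀ z : σ → ℂ, (fun k x => MvPolynomial.eval z (shiftFamily s B
      (fun j i (_ : Y) => MvPolynomial.C (c j i) * MvPolynomial.X i) k x)) =
      shiftFamily s B fun j i (_ : Y) => c j i * z i := by
    intro z
    ext k x
    rcases k with b | ⟨j, y⟩
    · simp [shiftFamily, Pi.single_apply, apply_ite]
    · simp [shiftFamily, Pi.single_apply, apply_ite]
  obtain ⟨P, hP, hz⟩ := exists_mvPolynomial_span_range_eq_top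
    (shiftFamily s B fun j i (_ : Y) => MvPolynomial.C (c j i) * MvPolynomial.X i) z₀
    (by rw [key, h])
  exact ⟨P, hP, fun z hPz => by rw [← key, hz z hPz]⟩

/-! ### Simplex coordinates and perturbation in the direction `η`. -/

namespace ToricCone

variable {V : Type*} [NormedAddCommGroup V] [NormedSpace ℝ V]
  {L : Submodule ℤ V} {K : PointedCone ℝ V} {d : ℕ} {e : Fin d → latticePoints L K}
  {T : Finset (Finset (Fin d))} {I J : Finset (Fin d)}

theorem mem_simplexCone {x : V} : x ∈ simplexCone e I ↔
    ∃ c : Fin d → ℝ, (∀ i ∈ I, 0 ≤ c i) ∧ x = ∑ i ∈ I, c i • (e i : V) := by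
  classical
  constructor
  · intro hx
    induction hx using Submodule.span_induction with
    | mem x hx =>
      obtain ⟨i, hi, rfl⟩ := hx
      refine ⟨Pi.single i 1, fun j _ => ?_, ?_⟩
      · by_cases h : j = i
        · subst h; simp
        · simp [h]
      · rw [Finset.sum_eq_single_of_mem i hi]
        · simp
        · intro j _ h
          simp [h]
    | zero => exact ⟨0, by simp, by simp⟩
    | add x y _ _ hx hy =>
      obtain ⟨c, hc, rfl⟩ := hx
      obtain ⟨c', hc', rfl⟩ := hy
      exact ⟨c + c', fun i hi => add_nonneg (hc i hi) (hc' i hi), by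
        simp [add_smul, Finset.sum_add_distrib]⟩
    | smul a x _ hx =>
      obtain ⟨c, hc, rfl⟩ := hx
      exact ⟨fun i => (a : ℝ) * c i, fun i hi => mul_nonneg a.2 (hc i hi), by
        simp [Finset.smul_sum, mul_smul]⟩
  · rintro ⟨c, hc, rfl⟩
    refine Submodule.sum_mem _ fun i hi => ?_
    exact Submodule.smul_mem _ (⟨c i, hc i hi⟩ : {c : ℝ // 0 ≤ c})
      (Submodule.subset_span ⟨i, hi, rfl⟩)

theorem simplexCone_le : simplexCone e I ≤ K := by
  refine Submodule.span_le.2 ?_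
  rintro _ ⟨i, -, rfl⟩
  exact (e i).2.2

/-- The linear forms `c i`, for `i ∈ I`, are the coordinates with respect to the `e i`. -/
structure IsSimplexCoord (e : Fin d → latticePoints L K) (I : Finset (Fin d))
    (c : Fin d → V →ₗ[ℝ] ℝ) : Prop where
  sum_eq : ∀ x, ∑ i ∈ I, c i x • (e i : V) = x
  apply_vertex : ∀ i ∈ I, ∀ j ∈ I, c i (e j) = if i = j then 1 else 0

namespace IsSimplexCoord

variable {c : Fin d → V →ₗ[ℝ] ℝ} (hc : IsSimplexCoord e I c)

include hc

theorem apply_sum (γ : Fin d → ℝ) {i : Fin d} (hi : i ∈ I) :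
    c i (∑ j ∈ I, γ j • (e j : V)) = γ i := by
  rw [map_sum, Finset.sum_eq_single_of_mem i hi]
  · simp [hc.apply_vertex i hi i hi]
  · intro j hj h
    simp [hc.apply_vertex i hi j hj, h.symm]

theorem mem_simplexCone_iff {x : V} : x ∈ simplexCone e I ↔ ∀ i ∈ I, 0 ≤ c i x := by
  rw [mem_simplexCone]
  constructor
  · rintro ⟨γ, hγ, rfl⟩ i hi
    rw [hc.apply_sum γ hi]
    exact hγ i hi
  · exact fun h => ⟨fun i => c i x, h, (hc.sum_eq x).symm⟩

end IsSimplexCoord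

/-- `x + ε η` lies in the interior of the cone over `I` for small `ε > 0`, where the interior is
described by the coordinates `c`. -/
def IsAdapted (I : Finset (Fin d)) (c : Fin d → V →ₗ[ℝ] ℝ) (η x : V) : Prop :=
  ∀ i ∈ I, ∀ᶠ ε : ℝ in 𝓝[>] 0, 0 < c i x + ε * c i η

/-- The right side is the lower half of the box inequalities, so being adapted encodes which facets
of a simplex cone are included. -/
theorem eventually_pos_add_mul_iff {γ β : ℝ} (hβ : β ≠ 0) :
    (∀ᶠ ε : ℝ in 𝓝[>] 0, 0 < γ + ε * β) ↔ 0 ≤ γ ∧ (β < 0 → 0 < γ) := by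
  have hcont : Tendsto (fun ε : ℝ => γ + ε * β) (𝓝[>] 0) (𝓝 γ) := by
    have : Continuous fun ε : ℝ => γ + ε * β := by fun_prop
    have h := (this.tendsto 0).mono_left (nhdsWithin_le_nhds (s := Set.Ioi 0))
    simpa using h
  have hpos : ∀ᶠ ε : ℝ in 𝓝[>] 0, 0 < ε := self_mem_nhdsWithin
  constructor
  · intro h
    refine ⟨ge_of_tendsto hcont (h.mono fun _ h => h.le), fun hb => ?_⟩
    obtain ⟨ε, h1, h2⟩ := (h.and hpos).exists
    nlinarith
  · rintro ⟨h0, hneg⟩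
    rcases h0.lt_or_eq with h | h
    · exact hcont.eventually_const_lt h
    · have hb : 0 < β := lt_of_le_of_ne (not_lt.1 fun hb => (hneg hb).ne h) hβ.symm
      filter_upwards [hpos] with ε hε
      rw [← h, zero_add]
      exact mul_pos hε hb

theorem eventually_neg_of_not_eventually_pos {γ β : ℝ} (hβ : β ≠ 0)
    (h : ¬ ∀ᶠ ε : ℝ in 𝓝[>] 0, 0 < γ + ε * β) : ∀ᶠ ε : ℝ in 𝓝[>] 0, γ + ε * β < 0 := by
  have h2 : ∀ᶠ ε : ℝ in 𝓝[>] 0, 0 < -γ + ε * -β := by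
    rw [eventually_pos_add_mul_iff (neg_ne_zero.2 hβ)]
    rw [eventually_pos_add_mul_iff hβ] at h
    refine ⟨?_, fun hb => ?_⟩
    · by_contra h'
      exact h ⟨by linarith, fun _ => by linarith⟩
    · by_contra h'
      exact h ⟨by linarith, fun _ => by linarith⟩
  filter_upwards [h2] with ε hε
  linarith

theorem IsAdapted.eventually_pos {c : Fin d → V →ₗ[ℝ] ℝ} {η x : V} (h : IsAdapted I c η x) :
    ∀ᶠ ε : ℝ in 𝓝[>] 0, ∀ i ∈ I, 0 < c i (x + ε • η) := by
  filter_upwards [(Finset.eventually_all I).2 h] with ε hε i hi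
  simpa using hε i hi

theorem IsAdapted.eventually_mem {c : Fin d → V →ₗ[ℝ] ℝ} (hc : IsSimplexCoord e I c) {η x : V}
    (h : IsAdapted I c η x) : ∀ᶠ ε : ℝ in 𝓝[>] 0, x + ε • η ∈ simplexCone e I :=
  h.eventually_pos.mono fun _ hε => hc.mem_simplexCone_iff.2 fun i hi => (hε i hi).le

theorem IsAdapted.mem {c : Fin d → V →ₗ[ℝ] ℝ} (hc : IsSimplexCoord e I c) {η x : V}
    (hη : ∀ i ∈ I, c i η ≠ 0) (h : IsAdapted I c η x) : x ∈ simplexCone e I :=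
  hc.mem_simplexCone_iff.2 fun i hi => ((eventually_pos_add_mul_iff (hη i hi)).1 (h i hi)).1

/-- Maximality enters here: `{i}` is itself a simplex, so its cone meets that of `I` in a common
face. -/
theorem IsMaximumRegularTriangulation.mem_of_vertex_mem
    (hT : IsMaximumRegularTriangulation e T) (hI : I ∈ T) {i : Fin d} (h0 : (e i : V) ≠ 0)
    (hi : (e i : V) ∈ simplexCone e I) : i ∈ I := by
  by_contra h
  have hmem : (e i : V) ∈ simplexCone e ({i} ∩ I) := by
    rw [← hT.inter_eq _ (hT.vertex i) I hI]
    exact ⟨Submodule.subset_span ⟨i, by simp, rfl⟩, hi⟩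
  obtain ⟨γ, -, hγ⟩ := mem_simplexCone.1 hmem
  rw [Finset.singleton_inter_of_notMem h] at hγ
  exact h0 (by simpa using hγ)

/-- Convexity at the midpoint, doubled; the doubling is legitimate because `ψ` is linear on a cone
containing `x + y`. -/
theorem IsStrictlyConvexSupport.map_add_le {ψ : V → ℝ}
    (hψ : IsStrictlyConvexSupport e T ψ)
    (hT : IsTriangulation e T) {x y : V} (hx : x ∈ K) (hy : y ∈ K) :
    ψ (x + y) ≤ ψ x + ψ y := by
  obtain ⟨I, hI, hxy⟩ := hT.cover _ (K.add_mem hx hy)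
  obtain ⟨l, hl⟩ := hψ.linear I hI.1
  have hhalf : (2⁻¹ : ℝ) • x + (2⁻¹ : ℝ) • y ∈ simplexCone e I := by
    rw [← smul_add]
    exact (simplexCone e I).smul_mem (by norm_num) hxy
  have h := hψ.convexOn.2 hx hy (by norm_num : (0 : ℝ) ≤ 2⁻¹) (by norm_num : (0 : ℝ) ≤ 2⁻¹)
    (by norm_num)
  rw [hl _ hhalf] at h
  rw [hl _ hxy]
  simp only [map_add, map_smul, smul_eq_mul] at h ⊢
  linarith

/-- Otherwise every maximal simplex has a coordinate that is eventually negative. There are finitely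
many, so some `x + ε • η` in `K` would lie in none of their cones. -/
theorem IsTriangulation.exists_isAdapted (hT : IsTriangulation e T)
    {c : Finset (Fin d) → Fin d → V →ₗ[ℝ] ℝ}
    (hc : ∀ I ∈ maxSimplices V T, IsSimplexCoord e I (c I)) {η x : V}
    (hη : ∀ I ∈ maxSimplices V T, ∀ i ∈ I, c I i η ≠ 0)
    (hx : ∀ᶠ ε : ℝ in 𝓝[>] 0, x + ε • η ∈ K) :
    ∃ I ∈ maxSimplices V T, IsAdapted I (c I) η x := by
  by_contra! hno
  have h1 : ∀ᶠ ε : ℝ in 𝓝[>] 0, ∀ I : Finset (Fin d), I ∈ maxSimplices V T →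
      x + ε • η ∉ simplexCone e I := by
    refine eventually_all.2 fun I => eventually_imp_distrib_left.2 fun hI => ?_
    have h2 := hno I hI
    unfold IsAdapted at h2
    push Not at h2
    obtain ⟨i, hi, h3⟩ := h2
    filter_upwards [eventually_neg_of_not_eventually_pos (hη I hI i hi)
      (by simpa using h3)] with ε hε hmem
    have := (hc I hI).mem_simplexCone_iff.1 hmem i hi
    rw [map_add, map_smul, smul_eq_mul] at this
    linarith
  obtain ⟨ε, h2, h3⟩ := (h1.and hx).exists
  obtain ⟨I, hI, h4⟩ := hT.cover _ h3
  exact h2 I hI h4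

/-! ### The linear pieces of `ψ` as supporting forms. -/

section Triangulation

variable [FiniteDimensional ℝ V]

theorem IsTriangulation.exists_isSimplexCoord (hT : IsTriangulation e T)
    (hI : I ∈ maxSimplices V T) : ∃ c : Fin d → V →ₗ[ℝ] ℝ, IsSimplexCoord e I c := by
  classical
  have hli := hT.linearIndependent I hI.1
  have hspan := hli.span_eq_top_of_card_eq_finrank' (by simpa using hI.2)
  let b : Module.Basis I ℝ V := Module.Basis.mk hli hspan.ge
  have hb : ∀ i, b i = (e i : V) := fun i => by simp [b]
  refine ⟨fun i => if h : i ∈ I then b.coord ⟨i, h⟩ else 0, ⟨fun x => ?_, ?_⟩⟩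
  · rw [← Finset.sum_attach]
    conv_rhs => rw [← b.sum_repr x]
    refine Finset.sum_congr rfl fun i _ => ?_
    simp [hb]
  · intro i hi j hj
    simp only [hi, dif_pos, b.coord_apply]
    rw [← hb ⟨j, hj⟩, b.repr_self, Finsupp.single_apply]
    simp [eq_comm]

theorem IsTriangulation.eq_of_pos (hT : IsTriangulation e T) (hI : I ∈ maxSimplices V T)
    {c : Fin d → V →ₗ[ℝ] ℝ} (hc : IsSimplexCoord e I c) (hJ : J ∈ T) {x : V}
    (hx : ∀ i ∈ I, 0 < c i x) (hxJ : x ∈ simplexCone e J) : J = I := by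
  have hxI : x ∈ simplexCone e I := hc.mem_simplexCone_iff.2 fun i hi => (hx i hi).le
  have hmem : x ∈ simplexCone e (I ∩ J) := by
    rw [← hT.inter_eq I hI.1 J hJ]
    exact ⟨hxI, hxJ⟩
  obtain ⟨γ, -, hγ⟩ := mem_simplexCone.1 hmem
  have hsub : I ⊆ J := by
    intro i hi
    by_contra hiJ
    have h0 : c i x = 0 := by
      rw [hγ, map_sum]
      refine Finset.sum_eq_zero fun j hj => ?_
      rw [Finset.mem_inter] at hj
      have hij : i ≠ j := fun h => hiJ (h ▸ hj.2)
      simp [hc.apply_vertex i hi j hj.1, hij]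
    exact (hx i hi).ne' h0
  refine (Finset.eq_of_subset_of_card_le hsub ?_).symm
  rw [hI.2]
  simpa using (hT.linearIndependent J hJ).fintype_card_le_finrank

variable {ψ : V → ℝ}

theorem IsStrictlyConvexSupport.apply_le (hψ : IsStrictlyConvexSupport e T ψ)
    (hT : IsTriangulation e T) (hI : I ∈ maxSimplices V T) {l : V →ₗ[ℝ] ℝ}
    (hl : ∀ x ∈ simplexCone e I, ψ x = l x) {x : V} (hx : x ∈ K) : l x ≤ ψ x := by
  obtain ⟨c, hc⟩ := hT.exists_isSimplexCoord hI
  -- Chosen so that `p + x` has coordinates `|c i x| + c i x ≥ 0`.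
  let p : V := ∑ i ∈ I, |c i x| • (e i : V)
  have hp : p ∈ simplexCone e I := mem_simplexCone.2 ⟨fun i => |c i x|, fun i _ => abs_nonneg _, rfl⟩
  have hpx : p + x ∈ simplexCone e I := hc.mem_simplexCone_iff.2 fun i hi => by
    rw [map_add, hc.apply_sum _ hi]
    linarith [neg_abs_le (c i x)]
  have h := hψ.map_add_le hT (simplexCone_le hp) hx
  rw [hl _ hpx, hl _ hp, map_add] at h
  linarith

theorem IsStrictlyConvexSupport.mem_simplexCone_of_eq (hψ : IsStrictlyConvexSupport e T ψ)
    (hT : IsTriangulation e T) (hI : I ∈ maxSimplices V T) {l : V →ₗ[ℝ] ℝ}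
    (hl : ∀ x ∈ simplexCone e I, ψ x = l x) {x : V} (hx : x ∈ K) (hlx : ψ x = l x) :
    x ∈ simplexCone e I := by
  obtain ⟨c, hc⟩ := hT.exists_isSimplexCoord hI
  -- An interior point of the cone over `I`; no other simplex has a cone containing it.
  let p : V := ∑ i ∈ I, (1 : ℝ) • (e i : V)
  have hp : p ∈ simplexCone e I := mem_simplexCone.2 ⟨fun _ => 1, fun i _ => zero_le_one, rfl⟩
  have h1 := hψ.map_add_le hT (simplexCone_le hp) hx
  have h2 := hψ.apply_le hT hI hl (K.add_mem (simplexCone_le hp) hx)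
  have h3 : ψ (p + x) = ψ p + ψ x := by
    refine le_antisymm h1 ?_
    rw [hl p hp, hlx, ← map_add]
    exact h2
  obtain ⟨J, hJ, hpJ, hxJ⟩ := hψ.strict p (simplexCone_le hp) x hx h3
  have hJI : J = I := hT.eq_of_pos hI hc hJ (fun i hi => by
    rw [hc.apply_sum (fun _ => 1) hi]
    exact one_pos) hpJ
  exact hJI ▸ hxJ

/-- This makes the induction decrease. Since `l' ≤ ψ` with equality at `x + e i`, additivity forces
equality at `x` and at `e i`. Comparing `l'` with `ψ = l` at `x + ε • η` gives `l' η ≤ l η`.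
Equality would put this interior point of the cone over `I` into the cone over `J`, so `J = I` and
then `i ∈ I`. -/
theorem IsMaximumRegularTriangulation.apply_lt_of_isAdapted
    (hT : IsMaximumRegularTriangulation e T) {ψ : V → ℝ} (hψ : IsStrictlyConvexSupport e T ψ)
    (hI : I ∈ maxSimplices V T) (hJ : J ∈ maxSimplices V T)
    {c c' : Fin d → V →ₗ[ℝ] ℝ} (hc : IsSimplexCoord e I c) (hc' : IsSimplexCoord e J c')
    {l l' : V →ₗ[ℝ] ℝ} (hl : ∀ x ∈ simplexCone e I, ψ x = l x)
    (hl' : ∀ x ∈ simplexCone e J, ψ x = l' x) {η x : V}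
    (hη : ∀ i ∈ I, c i η ≠ 0) (hη' : ∀ i ∈ J, c' i η ≠ 0)
    (hx : IsAdapted I c η x) {i : Fin d} (hi : i ∉ I) (h0 : (e i : V) ≠ 0)
    (hadd : ψ (x + e i) = ψ x + ψ (e i)) (hxi : IsAdapted J c' η (x + e i)) : l' η < l η := by
  have hxI := hx.mem hc hη
  have hxK := simplexCone_le hxI
  have h1 := hψ.apply_le hT.toIsTriangulation hJ hl' hxK
  have h2 := hψ.apply_le hT.toIsTriangulation hJ hl' (e i).2.2
  rw [hl' _ (hxi.mem hc' hη'), map_add] at hadd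
  have h3 : ψ x = l' x := by linarith
  have h4 : ψ (e i) = l' (e i) := by linarith
  have h5 := hl x hxI
  obtain ⟨ε, ⟨hpos, hmem⟩, hε : 0 < ε⟩ :=
    ((hx.eventually_pos.and (hx.eventually_mem hc)).and self_mem_nhdsWithin).exists
  have h6 := hψ.apply_le hT.toIsTriangulation hJ hl' (simplexCone_le hmem)
  have h7 := hl _ hmem
  simp only [map_add, map_smul, smul_eq_mul] at h6 h7
  have h8 : l' η ≤ l η := by
    have : ε * l' η ≤ ε * l η := by linarith
    exact le_of_mul_le_mul_left this hε
  refine lt_of_le_of_ne h8 fun h9 => hi ?_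
  have h10 : x + ε • η ∈ simplexCone e J := by
    refine hψ.mem_simplexCone_of_eq hT.toIsTriangulation hJ hl' (simplexCone_le hmem) ?_
    simp only [map_add, map_smul, smul_eq_mul]
    rw [h7, h9]
    linarith
  have hJI : J = I := hT.eq_of_pos hI hc hJ.1 hpos h10
  rw [← hJI]
  exact hT.mem_of_vertex_mem hJ.1 h0
    (hψ.mem_simplexCone_of_eq hT.toIsTriangulation hJ hl' (e i).2.2 h4)

end Triangulation

end ToricCone

namespace ToricCone

/-! ### Real linear forms as elements of `M ⊗ ℂ`. -/

section Lattice

variable {V : Type*} [NormedAddCommGroup V] [NormedSpace ℝ V] [FiniteDimensional ℝ V]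
  {L : Submodule ℤ V} [DiscreteTopology L] [IsZLattice ℝ L]

theorem exists_linearMap_extending_dual (deg : Module.Dual ℤ L) :
    ∃ D : V →ₗ[ℝ] ℝ, ∀ n : L, D n = deg n := by
  have : Module.Finite ℤ L := ZLattice.module_finite ℝ L
  have : Module.Free ℤ L := ZLattice.module_free ℝ L
  let b := Module.Free.chooseBasis ℤ L
  refine ⟨(b.ofZLatticeBasis ℝ L).constr ℝ fun i => (deg (b i) : ℝ), fun n => ?_⟩
  rw [Module.Basis.constr_apply_fintype]
  conv_rhs => rw [← b.sum_repr n, map_sum]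
  simp [Module.Basis.equivFun_apply]

theorem exists_pairing_eq (f : V →ₗ[ℝ] ℝ) :
    ∃ μ : ℂ ⊗[ℤ] Module.Dual ℤ L, ∀ n : L, pairing L μ n = (f n : ℂ) := by
  have : Module.Finite ℤ L := ZLattice.module_finite ℝ L
  have : Module.Free ℤ L := ZLattice.module_free ℝ L
  let b := Module.Free.chooseBasis ℤ L
  refine ⟨∑ i, (f (b i) : ℂ) ⊗ₜ b.coord i, fun n => ?_⟩
  have hn : (n : V) = ∑ i, (b.repr n i : ℝ) • (b i : V) := by
    conv_lhs => rw [← (b.ofZLatticeBasis ℝ L).sum_repr (n : V)]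
    simp
  rw [hn]
  simp [pairing]

/-- Simplex coordinates need not be integral on `N`, but they are still complex combinations of the
`m j`, so they give relations. -/
theorem exists_sum_pairing_eq {J : Type*} [Fintype J]
    (m : Module.Basis J ℂ (ℂ ⊗[ℤ] Module.Dual ℤ L)) (f : V →ₗ[ℝ] ℝ) :
    ∃ a : J → ℂ, ∀ n : L, ∑ j, a j * pairing L (m j) n = (f n : ℂ) := by
  obtain ⟨μ, hμ⟩ := exists_pairing_eq (L := L) f
  refine ⟨fun j => m.repr μ j, fun n => ?_⟩
  rw [← hμ n]
  unfold pairing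
  conv_rhs => rw [← m.sum_repr μ, map_sum]
  simp

end Lattice

/-! ### Graded pieces, reduction to box points and the degenerate ring. -/

variable {V : Type*} [NormedAddCommGroup V] [NormedSpace ℝ V]
  {L : Submodule ℤ V} {K : PointedCone ℝ V} {d : ℕ} {e : Fin d → latticePoints L K}
  {T : Finset (Finset (Fin d))} {I : Finset (Fin d)} {η : V}

/-- The points `n` of `K ∩ N` such that `n + ε η` lies in `K` for small `ε > 0`. -/
def directedPoints (L : Submodule ℤ V) (K : PointedCone ℝ V) (η : V) : Set (latticePoints L K) :=
  {n | ∀ᶠ ε : ℝ in 𝓝[>] 0, (n : V) + ε • η ∈ K}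

theorem add_mem_directedPoints {n : latticePoints L K} (hn : n ∈ directedPoints L K η)
    (k : latticePoints L K) : n + k ∈ directedPoints L K η := by
  have h : ∀ᶠ ε : ℝ in 𝓝[>] 0, (n : V) + ε • η ∈ K := hn
  refine h.mono fun ε hε => ?_
  have := K.add_mem hε k.2.2
  rwa [add_right_comm] at this

theorem IsAdapted.mem_directedPoints {c : Fin d → V →ₗ[ℝ] ℝ} (hc : IsSimplexCoord e I c)
    {n : latticePoints L K} (h : IsAdapted I c η n) : n ∈ directedPoints L K η :=
  (h.eventually_mem hc).mono fun _ hε => simplexCone_le hε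

theorem smul_mem_interior {x : V} (hx : x ∈ interior (K : Set V)) {ε : ℝ} (hε : 0 < ε) :
    ε • x ∈ interior (K : Set V) := by
  have h : (fun z => ε • z) '' interior (K : Set V) ⊆ (K : Set V) := by
    rintro _ ⟨z, hz, rfl⟩
    exact K.smul_mem hε.le (interior_subset hz)
  exact interior_maximal h (isOpenMap_smul₀ hε.ne' _ isOpen_interior) ⟨x, hx, rfl⟩

theorem directedPoints_eq_univ (hη : η ∈ K) : directedPoints L K η = Set.univ := by
  refine Set.eq_univ_of_forall fun n => ?_
  filter_upwards [self_mem_nhdsWithin] with ε (hε : 0 < ε)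
  exact K.add_mem n.2.2 (K.smul_mem hε.le hη)

theorem mem_directedPoints_neg_iff (hη : η ∈ interior (K : Set V)) {n : latticePoints L K} :
    n ∈ directedPoints L K (-η) ↔ (n : V) ∈ interior (K : Set V) := by
  constructor
  · intro (h : ∀ᶠ ε : ℝ in 𝓝[>] 0, (n : V) + ε • -η ∈ K)
    obtain ⟨ε, h1, h2 : (0 : ℝ) < ε⟩ := (h.and self_mem_nhdsWithin).exists
    have := add_mem_interior h1 (smul_mem_interior hη h2)
    simpa using this
  · intro h
    have hcont : Continuous fun ε : ℝ => (n : V) + ε • -η := by fun_prop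
    have h1 : Tendsto (fun ε : ℝ => (n : V) + ε • -η) (𝓝[>] 0) (𝓝 (n : V)) := by
      simpa using (hcont.tendsto 0).mono_left (nhdsWithin_le_nhds (s := Set.Ioi 0))
    exact h1.eventually (mem_interior_iff_mem_nhds.1 h)

/-- The points of `directedPoints` of degree `k` with respect to the linear form `D`. -/
def gradedPoints (L : Submodule ℤ V) (K : PointedCone ℝ V) (η : V) (D : V →ₗ[ℝ] ℝ) (k : ℝ) :
    Set (latticePoints L K) :=
  {n | n ∈ directedPoints L K η ∧ D n = k}

/-- The degree is the sum of the non-negative simplex coordinates, so it bounds the norm; the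
lattice is discrete. -/
theorem gradedPoints_finite [FiniteDimensional ℝ V] [DiscreteTopology L]
    (hT : IsTriangulation e T) {D : V →ₗ[ℝ] ℝ} (hD : ∀ i, D (e i) = 1) (k : ℝ) :
    (gradedPoints L K η D k).Finite := by
  have hfin : (Metric.closedBall (0 : V) (k * ∑ i, ‖(e i : V)‖) ∩ (L : Set V)).Finite := by
    change ((_ : Set V) ∩ L.toAddSubgroup).Finite
    have : DiscreteTopology L.toAddSubgroup := (inferInstance : DiscreteTopology L)
    exact Metric.finite_isBounded_inter_isClosed DiscreteTopology.isDiscrete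
      Metric.isBounded_closedBall inferInstance
  refine Set.Finite.of_finite_image (f := fun n : latticePoints L K => (n : V))
    (hfin.subset ?_) Subtype.val_injective.injOn
  rintro _ ⟨n, ⟨-, hn⟩, rfl⟩
  refine ⟨?_, n.2.1⟩
  obtain ⟨I, hI, hmem⟩ := hT.cover n n.2.2
  obtain ⟨γ, hγ, h⟩ := mem_simplexCone.1 hmem
  have hk : ∑ i ∈ I, γ i = k := by
    rw [← hn, h]
    simp [hD]
  rw [mem_closedBall_zero_iff]
  dsimp only
  rw [h, ← hk, Finset.sum_mul]
  refine (norm_sum_le _ _).trans (Finset.sum_le_sum fun i hi => ?_)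
  rw [norm_smul, Real.norm_of_nonneg (hγ i hi)]
  exact mul_le_mul_of_nonneg_left
    (Finset.single_le_sum (f := fun i => ‖(e i : V)‖) (fun i _ => norm_nonneg _)
      (Finset.mem_univ i)) (hγ i hi)

/-- Adding a vertex raises the degree by one. -/
def addVertex {D : V →ₗ[ℝ] ℝ} (hD : ∀ i, D (e i) = 1) (k : ℝ) (i : Fin d)
    (n : gradedPoints L K η D (k - 1)) : gradedPoints L K η D k :=
  ⟨n.1 + e i, add_mem_directedPoints n.2.1 _, by
    have := n.2.2
    simp [hD, this]⟩

/-- Being adapted gives the lower box bounds. If an upper bound fails at `i`, subtracting `e i`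
preserves the lower ones. -/
theorem mem_boxSet_or_exists_eq_add {c : Fin d → V →ₗ[ℝ] ℝ} (hc : IsSimplexCoord e I c)
    (hη : ∀ i ∈ I, c i η ≠ 0) {n : latticePoints L K} (hn : IsAdapted I c η n) :
    n ∈ boxSet e I η ∨ ∃ i ∈ I, ∃ n' : latticePoints L K, n = n' + e i ∧ IsAdapted I c η n' := by
  by_cases hbox : ∀ i ∈ I, (c i η < 0 → c i n ≤ 1) ∧ (0 < c i η → c i n < 1)
  · left
    refine ⟨fun i => c i η, fun i => c i n, (hc.sum_eq _).symm, (hc.sum_eq _).symm,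
      fun i hi => ?_⟩
    have h := (eventually_pos_add_mul_iff (hη i hi)).1 (hn i hi)
    exact ⟨fun h' => ⟨h.2 h', (hbox i hi).1 h'⟩, fun h' => ⟨h.1, (hbox i hi).2 h'⟩⟩
  · right
    push Not at hbox
    obtain ⟨i, hi, h⟩ := hbox
    have had : IsAdapted I c η ((n : V) - e i) := by
      intro j hj
      have hjn := (eventually_pos_add_mul_iff (hη j hj)).1 (hn j hj)
      rw [eventually_pos_add_mul_iff (hη j hj), map_sub, hc.apply_vertex j hj i hi]
      split_ifs with hji
      · subst hji
        by_cases hneg : c j η < 0 → c j n ≤ 1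
        · have h2 := h hneg
          exact ⟨by linarith, fun h3 => by linarith⟩
        · push Not at hneg
          exact ⟨by linarith, fun h3 => by linarith⟩
      · simpa using hjn
    refine ⟨i, hi, ⟨(n : V) - e i, L.sub_mem n.2.1 (e i).2.1, simplexCone_le (had.mem hc hη)⟩,
      ?_, had⟩
    ext
    simp

theorem apply_le_finrank_of_mem_boxUnion {c : Finset (Fin d) → Fin d → V →ₗ[ℝ] ℝ}
    (hc : ∀ I ∈ maxSimplices V T, IsSimplexCoord e I (c I))
    (hη : ∀ I ∈ maxSimplices V T, ∀ i ∈ I, c I i η ≠ 0)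
    {D : V →ₗ[ℝ] ℝ} (hD : ∀ i, D (e i) = 1) {b : latticePoints L K} (hb : b ∈ boxUnion e T η) :
    D b ≤ Module.finrank ℝ V := by
  obtain ⟨I, hI, β, γ, hβ, hγ, h⟩ := hb
  have h1 : D b = ∑ i ∈ I, γ i := by
    rw [hγ]
    simp [hD]
  rw [h1, ← hI.2]
  refine (Finset.sum_le_card_nsmul I γ 1 fun i hi => ?_).trans (by simp)
  have hne : β i ≠ 0 := by
    rw [← (hc I hI).apply_sum β hi, ← hβ]
    exact hη I hI i hi
  rcases lt_or_gt_of_ne hne with h' | h'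
  · exact ((h i hi).1 h').2
  · exact ((h i hi).2 h').2.le

/-- The degenerate ring, in which `x ^ n * x ^ e_i` is zero unless `n` and `e_i` lie in a common
cone, is spanned modulo the linear elements by the monomials of the box points. -/
theorem span_shiftFamily_eq_top_of_support [FiniteDimensional ℝ V] [DiscreteTopology L]
    [IsZLattice ℝ L] (hT : IsMaximumRegularTriangulation e T) {ψ : V → ℝ}
    (hψ : IsStrictlyConvexSupport e T ψ) {c : Finset (Fin d) → Fin d → V →ₗ[ℝ] ℝ}
    (hc : ∀ I ∈ maxSimplices V T, IsSimplexCoord e I (c I))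
    (hη : ∀ I ∈ maxSimplices V T, ∀ i ∈ I, c I i η ≠ 0)
    {D : V →ₗ[ℝ] ℝ} (hD : ∀ i, D (e i) = 1) {J : Type*} [Fintype J]
    (m : Module.Basis J ℂ (ℂ ⊗[ℤ] Module.Dual ℤ L)) (k : ℝ) :
    open Classical in Submodule.span ℂ (Set.range (shiftFamily (addVertex (η := η) hD k)
      {n | n.1 ∈ boxUnion e T η} fun j i (n : gradedPoints L K η D (k - 1)) =>
        if ψ (addVertex hD k i n).1 = ψ n.1 + ψ (e i) then
          pairing L (m j) (toLattice (e i)) else 0)) = ⊤ := by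
  classical
  set F := shiftFamily (addVertex (η := η) hD k)
      {n | n.1 ∈ boxUnion e T η} fun j i (n : gradedPoints L K η D (k - 1)) =>
        if ψ (addVertex hD k i n).1 = ψ n.1 + ψ (e i) then
          pairing L (m j) (toLattice (e i)) else 0 with hF
  have hX : Finite (gradedPoints L K η D k) := gradedPoints_finite hT.toIsTriangulation hD k
  have hlin : ∀ I, ∃ l : V →ₗ[ℝ] ℝ, I ∈ maxSimplices V T → ∀ x ∈ simplexCone e I, ψ x = l x := by
    intro I
    by_cases hI : I ∈ maxSimplices V T
    · obtain ⟨l, hl⟩ := hψ.linear I hI.1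
      exact ⟨l, fun _ => hl⟩
    · exact ⟨0, fun h => absurd h hI⟩
  choose l hl using hlin
  have hne : ∀ i, (e i : V) ≠ 0 := fun i h => by
    have := hD i
    rw [h, map_zero] at this
    exact zero_ne_one this
  -- The induction runs over the finitely many simplices, ordered by the value at `η` of their
  -- linear piece of `ψ`.
  have wf : WellFounded fun I J : Finset (Fin d) => l I η < l J η := by
    have : IsTrans (Finset (Fin d)) fun I J => l I η < l J η := ⟨fun _ _ _ => lt_trans⟩
    have : Std.Irrefl fun I J : Finset (Fin d) => l I η < l J η := ⟨fun _ => lt_irrefl _⟩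
    exact Finite.wellFounded_of_trans_of_irrefl _
  have key : ∀ I, I ∈ maxSimplices V T → ∀ n : gradedPoints L K η D k,
      IsAdapted I (c I) η n.1 → Pi.single n (1 : ℂ) ∈ Submodule.span ℂ (Set.range F) := by
    intro I
    induction I using wf.induction with
    | _ I ih =>
    intro hI n hn
    rcases mem_boxSet_or_exists_eq_add (hc I hI) (hη I hI) hn with hb | ⟨i, hi, n', hnn', hn'⟩
    · refine Submodule.subset_span ⟨Sum.inl ⟨n, I, hI, hb⟩, ?_⟩
      simp only [hF, shiftFamily, Sum.elim_inl]
      congr!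
    · have hDn' : D n' = k - 1 := by
        have h1 := n.2.2
        rw [hnn'] at h1
        push_cast at h1
        rw [map_add, hD] at h1
        linarith
      let y : gradedPoints L K η D (k - 1) := ⟨n', hn'.mem_directedPoints (hc I hI), hDn'⟩
      -- This form is `1` at `e i` and `0` at the other vertices of `I`: the relation at `n'`
      -- isolates `n`, up to vertices outside `I`.
      obtain ⟨a, ha⟩ := exists_sum_pairing_eq m (c I i)
      have hsum : ∑ j, a j • F (Sum.inr (j, y)) = ∑ i', Pi.single (addVertex hD k i' y)
          (if ψ (addVertex hD k i' y).1 = ψ n' + ψ (e i') then (c I i (e i') : ℂ) else 0) := by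
        simp only [hF, shiftFamily, Sum.elim_inr, Finset.smul_sum]
        rw [Finset.sum_comm]
        refine Finset.sum_congr rfl fun i' _ => ?_
        ext x
        simp only [Finset.sum_apply, Pi.smul_apply, Pi.single_apply, smul_eq_mul]
        split_ifs with h1 h2
        · exact ha _
        · simp
        · simp
      have hmem : ∑ j, a j • F (Sum.inr (j, y)) ∈ Submodule.span ℂ (Set.range F) :=
        Submodule.sum_mem _ fun j _ => Submodule.smul_mem _ _ (Submodule.subset_span ⟨_, rfl⟩)
      rw [hsum, ← Finset.add_sum_erase _ _ (Finset.mem_univ i)] at hmem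
      have hn'I := hn'.mem (hc I hI) (hη I hI)
      have hiI : (e i : V) ∈ simplexCone e I := Submodule.subset_span ⟨i, hi, rfl⟩
      have hadd : ψ (addVertex hD k i y).1 = ψ n' + ψ (e i) := by
        change ψ ((n' : V) + e i) = _
        rw [hl I hI _ hn'I, hl I hI _ hiI, hl I hI _ ((simplexCone e I).add_mem hn'I hiI),
          map_add]
      have hny : addVertex hD k i y = n := Subtype.ext hnn'.symm
      rw [if_pos hadd, (hc I hI).apply_vertex i hi i hi, if_pos rfl, hny,
        Complex.ofReal_one] at hmem
      refine (Submodule.add_mem_iff_left _ (Submodule.sum_mem _ fun i' hi' => ?_)).1 hmem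
      split_ifs with h1
      · by_cases hi'I : i' ∈ I
        · rw [(hc I hI).apply_vertex i hi i' hi'I, if_neg (Finset.ne_of_mem_erase hi').symm]
          simp
        · obtain ⟨I', hI', had⟩ := hT.exists_isAdapted hc hη (addVertex hD k i' y).2.1
          have hlt := hT.apply_lt_of_isAdapted hψ hI hI' (hc I hI) (hc I' hI') (hl I hI)
            (hl I' hI') (hη I hI) (hη I' hI') hn' hi'I (hne i') h1 had
          have h2 := Submodule.smul_mem _ (c I i (e i') : ℂ) (ih I' hlt hI' _ had)
          rwa [← Pi.single_smul, smul_eq_mul, mul_one] at h2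
      · simp
  have := Fintype.ofFinite (gradedPoints L K η D k)
  rw [eq_top_iff, ← (Pi.basisFun ℂ (gradedPoints L K η D k)).span_eq, Submodule.span_le]
  rintro _ ⟨n, rfl⟩
  obtain ⟨I, hI, had⟩ := hT.exists_isAdapted hc hη n.2.1
  rw [Pi.basisFun_apply, SetLike.mem_coe]
  convert key I hI n had

end ToricCone

/-! ### From graded pieces to the quotients. -/

namespace ToricCone

variable {V : Type*} [NormedAddCommGroup V] [NormedSpace ℝ V]
  {L : Submodule ℤ V} {K : PointedCone ℝ V} {d : ℕ} {e : Fin d → latticePoints L K}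
  {T : Finset (Finset (Fin d))} {I : Finset (Fin d)} {η : V}

/-- The element `∑ i, ⟨m, e_i⟩ z_i x_i` of `ℂ[K]`. -/
noncomputable def weightedElement (e : Fin d → latticePoints L K) (z : Fin d → ℂ)
    (m : ℂ ⊗[ℤ] Module.Dual ℤ L) : coneRing L K :=
  ∑ i, (pairing L m (toLattice (e i)) * z i) • monom (e i)

theorem monom_add (n k : latticePoints L K) : monom (n + k) = monom n * monom k := by
  simp [monom, AddMonoidAlgebra.single_mul_single]

/-- The `ℂ`-span of the products of the elements `∑ i, ⟨m_j, e_i⟩ z_i x_i` with the monomials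
`x ^ n`, for `n` in `directedPoints`. -/
noncomputable def linearSpan {J : Type*} (e : Fin d → latticePoints L K) (z : Fin d → ℂ)
    (m : J → ℂ ⊗[ℤ] Module.Dual ℤ L) (η : V) : Submodule ℂ (coneRing L K) :=
  Submodule.span ℂ {f | ∃ j, ∃ n ∈ directedPoints L K η, f = weightedElement e z (m j) * monom n}

theorem mul_monom_mem_linearSpan {J : Type*} {z : Fin d → ℂ} {m : J → ℂ ⊗[ℤ] Module.Dual ℤ L}
    {f : coneRing L K} (hf : f ∈ linearSpan e z m η) (k : latticePoints L K) :
    f * monom k ∈ linearSpan e z m η := by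
  have h : linearSpan e z m η ≤
      (linearSpan e z m η).comap (LinearMap.mulRight ℂ (monom k)) := by
    refine Submodule.span_le.2 ?_
    rintro _ ⟨j, n, hn, rfl⟩
    refine Submodule.subset_span ⟨j, n + k, add_mem_directedPoints hn k, ?_⟩
    rw [LinearMap.mulRight_apply, monom_add, mul_assoc]
  exact h hf

theorem monom_mem_of_span_shiftFamily_eq_top {D : V →ₗ[ℝ] ℝ} (hD : ∀ i, D (e i) = 1) {J : Type*}
    (m : J → ℂ ⊗[ℤ] Module.Dual ℤ L) (k : ℝ) [Finite (gradedPoints L K η D k)] (z : Fin d → ℂ)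
    (h : Submodule.span ℂ (Set.range (shiftFamily (addVertex (η := η) hD k)
      {n | n.1 ∈ boxUnion e T η} fun j i (_ : gradedPoints L K η D (k - 1)) =>
        pairing L (m j) (toLattice (e i)) * z i)) = ⊤)
    {n : latticePoints L K} (hn : n ∈ gradedPoints L K η D k) :
    monom n ∈ Submodule.span ℂ (monom '' (boxUnion e T η ∩ gradedPoints L K η D k)) ⊔
      linearSpan e z m η := by
  classical
  have := Fintype.ofFinite (gradedPoints L K η D k)
  let Φ : (gradedPoints L K η D k → ℂ) →ₗ[ℂ] coneRing L K :=
    Fintype.linearCombination ℂ fun n => monom n.1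
  have hΦ : ∀ (n : gradedPoints L K η D k) (a : ℂ), Φ (Pi.single n a) = a • monom n.1 := by
    intro n a
    simp [Φ, Fintype.linearCombination_apply_single]
  have hmem : Φ (Pi.single ⟨n, hn⟩ 1) ∈ (⊤ : Submodule ℂ _).map Φ :=
    Submodule.mem_map_of_mem trivial
  rw [hΦ, one_smul, ← h, Submodule.map_span] at hmem
  refine Submodule.span_le.2 ?_ hmem
  rintro _ ⟨_, ⟨b | ⟨j, y⟩, rfl⟩, rfl⟩
  · refine Submodule.mem_sup_left (Submodule.subset_span ⟨b.1.1, ⟨b.2, b.1.2⟩, ?_⟩)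
    have h1 := hΦ b.1 1
    rw [one_smul] at h1
    rw [← h1]
    simp only [shiftFamily, Sum.elim_inl]
    congr!
  · refine Submodule.mem_sup_right (Submodule.subset_span ⟨j, y.1, y.2.1, ?_⟩)
    have h1 : shiftFamily (addVertex (η := η) hD k) {n | n.1 ∈ boxUnion e T η}
        (fun j i (_ : gradedPoints L K η D (k - 1)) =>
          pairing L (m j) (toLattice (e i)) * z i) (Sum.inr (j, y)) =
        ∑ i, Pi.single (addVertex hD k i y) (pairing L (m j) (toLattice (e i)) * z i) := by
      simp only [shiftFamily, Sum.elim_inr]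
      congr!
    rw [h1, map_sum, weightedElement, Finset.sum_mul]
    refine Finset.sum_congr rfl fun i _ => ?_
    rw [hΦ, smul_mul_assoc, ← monom_add, add_comm (e i)]
    rfl

/-- One polynomial per degree is available, and degrees up to `r + 1` suffice. Box points have
degree at most `r`, so all of degree `r + 1` lies in `linearSpan`, which is stable under
multiplication by monomials. -/
theorem exists_mvPolynomial_monom_mem [FiniteDimensional ℝ V] [DiscreteTopology L]
    [IsZLattice ℝ L] {deg : Module.Dual ℤ L} (hK : IsGradedCone deg e)
    (hT : IsMaximumRegularTriangulation e T)
    (hη : ∀ I ∈ maxSimplices V T, ∀ β : Fin d → ℝ, η = ∑ i ∈ I, β i • (e i : V) →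
      ∀ i ∈ I, β i ≠ 0)
    {J : Type*} [Fintype J] (m : Module.Basis J ℂ (ℂ ⊗[ℤ] Module.Dual ℤ L)) :
    ∃ P : MvPolynomial (Fin d) ℂ, P ≠ 0 ∧ ∀ z, MvPolynomial.eval z P ≠ 0 →
      ∀ n ∈ directedPoints L K η, monom n ∈
        Submodule.span ℂ (monom '' (boxUnion e T η ∩ directedPoints L K η)) ⊔
          linearSpan e z m η := by
  classical
  obtain ⟨D, hdeg⟩ := exists_linearMap_extending_dual deg
  have hD : ∀ i, D (e i) = 1 := fun i => by
    have := hdeg (toLattice (e i))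
    rw [hK.deg_eq_one] at this
    simpa [toLattice] using this
  obtain ⟨ψ, hψ⟩ := hT.regular
  have hcoord : ∀ I, ∃ c : Fin d → V →ₗ[ℝ] ℝ, I ∈ maxSimplices V T → IsSimplexCoord e I c := by
    intro I
    by_cases hI : I ∈ maxSimplices V T
    · obtain ⟨c, hc⟩ := hT.exists_isSimplexCoord hI
      exact ⟨c, fun _ => hc⟩
    · exact ⟨0, fun h => absurd h hI⟩
  choose c hc using hcoord
  have hcη : ∀ I ∈ maxSimplices V T, ∀ i ∈ I, c I i η ≠ 0 := fun I hI =>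
    hη I hI (fun i => c I i η) ((hc I hI).sum_eq η).symm
  have hfin : ∀ k : ℝ, Finite (gradedPoints L K η D k) :=
    gradedPoints_finite hT.toIsTriangulation hD
  have hP : ∀ k : ℕ, ∃ P : MvPolynomial (Fin d) ℂ, P ≠ 0 ∧ ∀ z, MvPolynomial.eval z P ≠ 0 →
      Submodule.span ℂ (Set.range (shiftFamily (addVertex (η := η) hD k)
      {n | n.1 ∈ boxUnion e T η} fun j i (_ : gradedPoints L K η D (k - 1)) =>
        pairing L (m j) (toLattice (e i)) * z i)) = ⊤ := by
    intro k
    obtain ⟨z₀, hz₀⟩ := exists_shiftFamily_span_eq_top (addVertex (η := η) hD k)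
      {n | n.1 ∈ boxUnion e T η} (fun j i => pairing L (m j) (toLattice (e i)))
      (fun n => ψ n.1) (fun n => ψ n.1) (fun i => ψ (e i))
      (fun i y => hψ.map_add_le hT.toIsTriangulation y.1.2.2 (e i).2.2)
      (span_shiftFamily_eq_top_of_support hT hψ hc hcη hD m k)
    exact exists_mvPolynomial_shiftFamily_span_eq_top _ _ _ z₀ hz₀
  choose P hP0 hPz using hP
  refine ⟨∏ k ∈ Finset.range (Module.finrank ℝ V + 2), P k,
    Finset.prod_ne_zero_iff.2 fun k _ => hP0 k, fun z hz => ?_⟩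
  rw [map_prod, Finset.prod_ne_zero_iff] at hz
  have hlow : ∀ k : ℕ, k < Module.finrank ℝ V + 2 → ∀ n ∈ gradedPoints L K η D k,
      monom n ∈ Submodule.span ℂ (monom '' (boxUnion e T η ∩ gradedPoints L K η D k)) ⊔
        linearSpan e z m η := fun k hk n hn =>
    monom_mem_of_span_shiftFamily_eq_top hD m k z (hPz k z (hz k (Finset.mem_range.2 hk))) hn
  have hboxD : ∀ b ∈ boxUnion e T η, D b ≤ Module.finrank ℝ V := fun b hb =>
    apply_le_finrank_of_mem_boxUnion hc hcη hD hb
  have hhigh : ∀ k : ℕ, Module.finrank ℝ V + 1 ≤ k → ∀ n ∈ gradedPoints L K η D k,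
      monom n ∈ linearSpan e z m η := by
    intro k hk
    induction k, hk using Nat.le_induction with
    | base =>
      intro n hn
      have h := hlow _ (Nat.lt_succ_self _) n hn
      have hempty : boxUnion e T η ∩ gradedPoints L K η D (Module.finrank ℝ V + 1 : ℕ) = ∅ := by
        refine Set.eq_empty_of_forall_notMem fun b hb => ?_
        have h1 := hboxD b hb.1
        rw [hb.2.2] at h1
        push_cast at h1
        linarith
      rwa [hempty, Set.image_empty, Submodule.span_empty, bot_sup_eq] at h
    | succ k hk ih =>
      intro n hn
      -- The degree is too large for a box point, so a vertex splits off.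
      obtain ⟨I, hI, had⟩ := hT.exists_isAdapted hc hcη hn.1
      rcases mem_boxSet_or_exists_eq_add (hc I hI) (hcη I hI) had with hb | ⟨i, -, n', rfl, hn'⟩
      · have h1 := hboxD n ⟨I, hI, hb⟩
        rw [hn.2] at h1
        have h2 : ((k + 1 : ℕ) : ℝ) ≤ Module.finrank ℝ V := h1
        rw [Nat.cast_le] at h2
        omega
      · rw [monom_add]
        refine mul_monom_mem_linearSpan (ih n' ⟨hn'.mem_directedPoints (hc I hI), ?_⟩) _
        have h1 := hn.2
        push_cast at h1
        rw [map_add, hD] at h1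
        linarith
  intro n hn
  -- The degree is non-negative on `K` and integral on the lattice.
  have hDn : ∃ k : ℕ, D n = k := by
    have h0 : 0 ≤ D n := by
      obtain ⟨I, -, hmem⟩ := hT.cover n n.2.2
      obtain ⟨γ, hγ, h⟩ := mem_simplexCone.1 hmem
      rw [h, map_sum]
      refine Finset.sum_nonneg fun i hi => ?_
      rw [map_smul, hD, smul_eq_mul, mul_one]
      exact hγ i hi
    have h1 : D n = deg (toLattice n) := hdeg (toLattice n)
    rw [h1] at h0 ⊢
    obtain ⟨k, hk⟩ := Int.eq_ofNat_of_zero_le (Int.cast_nonneg_iff.1 h0)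
    exact ⟨k, by rw [hk]; simp⟩
  obtain ⟨k, hk⟩ := hDn
  rcases lt_or_ge k (Module.finrank ℝ V + 2) with h | h
  · have hsub : boxUnion e T η ∩ gradedPoints L K η D k ⊆ boxUnion e T η ∩ directedPoints L K η :=
      fun b hb => ⟨hb.1, hb.2.1⟩
    exact sup_le_sup_right (Submodule.span_mono (Set.image_mono hsub)) (linearSpan e z m η)
      (hlow k h n ⟨hn, hk⟩)
  · exact Submodule.mem_sup_right (hhigh k (by omega) n ⟨hn, hk⟩)

theorem mem_span_monom_of_support_subset {f : coneRing L K} {S : Set (latticePoints L K)}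
    (hf : ∀ n ∈ f.coeff.support, n ∈ S) : f ∈ Submodule.span ℂ (monom '' S) := by
  have h := AddMonoidAlgebra.supported_eq_span_single (R := ℂ) (s := S)
  change f ∈ Submodule.span ℂ ((fun n => AddMonoidAlgebra.single n (1 : ℂ)) '' S)
  rw [← h]
  exact hf

theorem monom_mem_openIdeal {n : latticePoints L K} (hn : (n : V) ∈ interior (K : Set V)) :
    monom n ∈ openIdeal L K := by
  classical
  intro k hk
  have h : k = n := by
    simpa [monom, Finsupp.single_apply, eq_comm] using hk
  exact h ▸ hn

variable {r : ℕ} {a : Fin d → ℂ} {m : Fin r → ℂ ⊗[ℤ] Module.Dual ℤ L}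

theorem linearElement_mem_idealZ (j : Fin r) : linearElement e a (m j) ∈ idealZ e a m :=
  Ideal.subset_span ⟨j, rfl⟩

theorem weightedElement_exp (μ : ℂ ⊗[ℤ] Module.Dual ℤ L) :
    weightedElement e (fun i => Complex.exp (2 * Real.pi * Complex.I * a i)) μ =
      linearElement e a μ :=
  rfl

theorem span_quotient_eq_top {B S : Set (latticePoints L K)} (hS : directedPoints L K η = Set.univ)
    (h : ∀ n ∈ directedPoints L K η, monom n ∈ Submodule.span ℂ (monom '' (B ∩ S)) ⊔
      linearSpan e (fun i => Complex.exp (2 * Real.pi * Complex.I * a i)) m η) :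
    Submodule.span ℂ {y : coneRing L K ⧸ idealZ e a m |
      ∃ b ∈ B, y = Ideal.Quotient.mk (idealZ e a m) (monom b)} = ⊤ := by
  set U := Submodule.span ℂ {y : coneRing L K ⧸ idealZ e a m |
      ∃ b ∈ B, y = Ideal.Quotient.mk (idealZ e a m) (monom b)} with hU
  let q : coneRing L K →ₗ[ℂ] coneRing L K ⧸ idealZ e a m :=
    (Ideal.Quotient.mkₐ ℂ (idealZ e a m)).toLinearMap
  have hle : Submodule.span ℂ (monom '' (B ∩ S)) ⊔
      linearSpan e (fun i => Complex.exp (2 * Real.pi * Complex.I * a i)) m η ≤ U.comap q := by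
    refine sup_le (Submodule.span_le.2 ?_) (Submodule.span_le.2 ?_)
    · rintro _ ⟨b, hb, rfl⟩
      exact Submodule.subset_span ⟨b, hb.1, rfl⟩
    · rintro _ ⟨j, n, -, rfl⟩
      have h0 : q (weightedElement e (fun i => Complex.exp (2 * Real.pi * Complex.I * a i)) (m j) *
          monom n) = 0 :=
        Ideal.Quotient.eq_zero_iff_mem.2
          (Ideal.mul_mem_right _ _ (linearElement_mem_idealZ j))
      rw [SetLike.mem_coe, Submodule.mem_comap, h0]
      exact U.zero_mem
  refine eq_top_iff.2 fun y _ => ?_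
  obtain ⟨f, rfl⟩ := Ideal.Quotient.mk_surjective y
  have hf : f ∈ Submodule.span ℂ (monom '' directedPoints L K η) :=
    mem_span_monom_of_support_subset fun n _ => hS ▸ Set.mem_univ n
  refine (Submodule.span_le.2 ?_ : _ ≤ U.comap q) hf
  rintro _ ⟨n, hn, rfl⟩
  exact hle (h n hn)

/-- The relations in `linearSpan` multiply linear elements only by interior monomials, so they lie
in `Z R^open`, not merely in `Z ∩ R^open`. -/
theorem span_openIdeal_quotient_eq_top {B : Set (latticePoints L K)}
    (hS : ∀ n, n ∈ directedPoints L K η ↔ (n : V) ∈ interior (K : Set V))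
    (h : ∀ n ∈ directedPoints L K η, monom n ∈
      Submodule.span ℂ (monom '' (B ∩ directedPoints L K η)) ⊔
        linearSpan e (fun i => Complex.exp (2 * Real.pi * Complex.I * a i)) m η) :
    Submodule.span ℂ {y : openIdeal L K ⧸
        (idealZ e a m • (⊤ : Submodule (coneRing L K) (openIdeal L K))) |
      ∃ b ∈ B, ∃ f : openIdeal L K, (f : coneRing L K) = monom b ∧
        y = Submodule.Quotient.mk f} = ⊤ := by
  set U := Submodule.span ℂ {y : openIdeal L K ⧸
        (idealZ e a m • (⊤ : Submodule (coneRing L K) (openIdeal L K))) |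
      ∃ b ∈ B, ∃ f : openIdeal L K, (f : coneRing L K) = monom b ∧
        y = Submodule.Quotient.mk f} with hU
  let q := (idealZ e a m • (⊤ : Submodule (coneRing L K) (openIdeal L K))).mkQ.restrictScalars ℂ
  -- The preimage of `U` in `R^open`, viewed inside `R`, where `linearSpan` lives.
  let W : Submodule ℂ (coneRing L K) :=
    (U.comap q).map ((openIdeal L K).subtype.restrictScalars ℂ)
  have hle : Submodule.span ℂ (monom '' (B ∩ directedPoints L K η)) ⊔
      linearSpan e (fun i => Complex.exp (2 * Real.pi * Complex.I * a i)) m η ≤ W := by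
    refine sup_le (Submodule.span_le.2 ?_) (Submodule.span_le.2 ?_)
    · rintro _ ⟨b, hb, rfl⟩
      exact ⟨⟨monom b, monom_mem_openIdeal ((hS b).1 hb.2)⟩,
        Submodule.subset_span ⟨b, hb.1, _, rfl, rfl⟩, rfl⟩
    · rintro _ ⟨j, n, hn, rfl⟩
      obtain ⟨g, hg⟩ : ∃ g : openIdeal L K, (g : coneRing L K) = monom n :=
        ⟨⟨monom n, monom_mem_openIdeal ((hS n).1 hn)⟩, rfl⟩
      rw [weightedElement_exp, ← hg]
      refine ⟨linearElement e a (m j) • g, ?_, by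
        rw [LinearMap.restrictScalars_apply, Submodule.subtype_apply, Submodule.coe_smul,
          smul_eq_mul]⟩
      have h0 : q (linearElement e a (m j) • g) = 0 :=
        (Submodule.Quotient.mk_eq_zero _).2
          (Submodule.smul_mem_smul (linearElement_mem_idealZ j) trivial)
      rw [SetLike.mem_coe, Submodule.mem_comap, h0]
      exact U.zero_mem
  refine eq_top_iff.2 fun y _ => ?_
  obtain ⟨f, rfl⟩ := Submodule.Quotient.mk_surjective _ y
  have hf : (f : coneRing L K) ∈ Submodule.span ℂ (monom '' directedPoints L K η) :=
    mem_span_monom_of_support_subset fun n hn => (hS n).2 (f.2 n hn)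
  have hfW : (f : coneRing L K) ∈ W := by
    refine (Submodule.span_le.2 ?_ : _ ≤ W) hf
    rintro _ ⟨n, hn, rfl⟩
    exact hle (h n hn)
  obtain ⟨g, hg, hgf⟩ := hfW
  rw [← Subtype.ext hgf]
  exact hg

end ToricCone

theorem mainTheorem3 {V : Type*} [NormedAddCommGroup V] [NormedSpace ℝ V]
    [FiniteDimensional ℝ V] (L : Submodule ℤ V) [DiscreteTopology L] [IsZLattice ℝ L]
    (K : PointedCone ℝ V) (deg : Module.Dual ℤ L) {d : ℕ}
    (e : Fin d → ToricCone.latticePoints L K) (hK : ToricCone.IsGradedCone deg e)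
    (T : Finset (Finset (Fin d))) (hT : ToricCone.IsMaximumRegularTriangulation e T)
    (ξ : V) (hξ : ToricCone.IsGenericInterior e T ξ)
    (m : Module.Basis (Fin (Module.finrank ℝ V)) ℂ (ℂ ⊗[ℤ] Module.Dual ℤ L)) :
    -- "for generic `a`": the numbers `exp(2 π i a_i)` avoid the zeros of a non-zero polynomial
    ∃ P : MvPolynomial (Fin d) ℂ, P ≠ 0 ∧
      ∀ a : Fin d → ℂ,
        MvPolynomial.eval (fun i => Complex.exp (2 * Real.pi * Complex.I * a i)) P ≠ 0 →
        Submodule.span ℂ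
            {y : ToricCone.coneRing L K ⧸ ToricCone.idealZ e a m |
              ∃ b ∈ ToricCone.boxUnion e T ξ,
                y = Ideal.Quotient.mk (ToricCone.idealZ e a m) (ToricCone.monom b)} = ⊤ ∧
        Submodule.span ℂ
            {y : ToricCone.openIdeal L K ⧸
                (ToricCone.idealZ e a m •
                  (⊤ : Submodule (ToricCone.coneRing L K) (ToricCone.openIdeal L K))) |
              ∃ b ∈ ToricCone.boxUnion e T (-ξ), ∃ f : ToricCone.openIdeal L K,
                (f : ToricCone.coneRing L K) = ToricCone.monom b ∧
                  y = Submodule.Quotient.mk f} = ⊤ := by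

  obtain ⟨P₁, hP₁, h₁⟩ := ToricCone.exists_mvPolynomial_monom_mem hK hT hξ.coord_ne_zero m
  -- The coordinates of `-ξ` are the negatives of those of `ξ`, hence non-zero.
  obtain ⟨P₂, hP₂, h₂⟩ := ToricCone.exists_mvPolynomial_monom_mem (η := -ξ) hK hT
    (fun I hI β hβ i hi h => hξ.coord_ne_zero I hI (fun i => -β i)
      (by rw [← neg_neg ξ, hβ]; simp) i hi (by simp [h])) m
  refine ⟨P₁ * P₂, mul_ne_zero hP₁ hP₂, fun a ha => ?_⟩
  rw [map_mul] at ha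
  exact ⟨ToricCone.span_quotient_eq_top
      (ToricCone.directedPoints_eq_univ (interior_subset hξ.mem_interior))
      (h₁ _ (left_ne_zero_of_mul ha)),
    ToricCone.span_openIdeal_quotient_eq_top
      (fun _ => ToricCone.mem_directedPoints_neg_iff hξ.mem_interior)
      (h₂ _ (right_ne_zero_of_mul ha))⟩
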